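/- Let $K$ be a number field with ring of integers $\mathcal O_K$, let $\lambda\in\mathcal O_K$ with $\lambda\neq 0,1$, and let $E$ be the Legendre elliptic curve $y^2=x(x+1)(x+\lambda)$ over $K$. Let $n\ge 4$ be an even integer. (1) There exist a finite Galois extension $K'/K$ with solvable Galois group, $n$ distinct roots $u_1,\dots,u_n\in K'$ of $X^n-\lambda$, and square roots $v_i\in K'$ of $\frac{u_i^{n-1}+1}{u_i+1}$ (one has $u_i\ne -1$ because $\lambda\neq 1$), such that the points $$P_i=\bigl(u_i,\;u_i(u_i+1)v_i\bigr),\qquad i=1,\dots,n,$$ are $n$ distinct $K'$-rational points of $E$. (2) Let $K'$ be any finite extension of $K$ containing such $u_i$ and $v_i$, and let $P_1,\dots,P_n\in E(K')$ be the corresponding points. Suppose that for every $i$ there are nonzero prime ideals $\mathfrak p,\mathfrak q$ of the ring of integers of $L_i=K(u_i,v_i)$, not lying over $(2)\subset\mathbb Z$ and with $\mathfrak p\cap\mathbb Z\neq\mathfrak q\cap\mathbb Z$, such that - $E$ (over $L_i$) has good reduction at $\mathfrak p$ and at $\mathfrak q$; - $v_i\in\mathfrak p\cap\mathfrak q$;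 - $u_i\notin\mathfrak p\cup\mathfrak q$ and $u_i+1\notin\mathfrak p\cup\mathfrak q$. Then every $P_i$ has infinite order in $E(K')$. -/

import Mathlib

open NumberField IsDedekindDomain

universe w

noncomputable section

/-- The Legendre curve `y² = x (x + 1) (x + t)`, that is `y² = x³ + (1 + t) x² + t x`. -/
def legendreCurve {F : Type*} [Field F] (t : F) : WeierstrassCurve F where
  a₁ := 0
  a₂ := 1 + t
  a₃ := 0
  a₄ := t
  a₆ := 0

/-- A Weierstrass curve `W` over a number field `L` has good reduction at the prime `𝔭` of `𝓞 L`: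
some (equivalently, every) minimal Weierstrass equation of `W` over the local ring
`(𝓞 L)_𝔭 = {x ∈ L : v_𝔭(x) ≤ 1}` (multiplicative notation) has unit discriminant. -/
def HasGoodReductionAt {L : Type*} [Field L] [NumberField L] (W : WeierstrassCurve L)
    (𝔭 : HeightOneSpectrum (𝓞 L)) : Prop :=
  ∃ C : WeierstrassCurve.VariableChange L,
    WeierstrassCurve.HasGoodReduction (𝔭.valuation L).integer (C • W)

/-- The element `x` of the number field `L` lies in the ideal `I` of `𝓞 L`
(in particular, `x` is an algebraic integer). -/
def LiesIn {L : Type*} [Field L] (x : L) (I : Ideal (𝓞 L)) : Prop :=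
  ∃ a ∈ I, (a : L) = x

/-- Conditions (0), (1), (2) at one prime `𝔭` of `𝓞 L`, where `𝔭` does not lie over `2`, for a
curve `W` over `L` and elements `u`, `v` of `L`. -/
structure ConditionsAt {L : Type*} [Field L] [NumberField L] (W : WeierstrassCurve L)
    (u v : L) (𝔭 : HeightOneSpectrum (𝓞 L)) : Prop where
  not_over_two : 𝔭.asIdeal.under ℤ ≠ Ideal.span {2}
  good_reduction : HasGoodReductionAt W 𝔭
  v_mem : LiesIn v 𝔭.asIdeal
  u_notMem : ¬ LiesIn u 𝔭.asIdeal
  u_add_one_notMem : ¬ LiesIn (u + 1) 𝔭.asIdeal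

/-- For elements `u`, `v` of a number field `K'` containing `K`, put `L = K(u, v) ⊆ K'`. There are
primes `𝔭`, `𝔮` of `𝓞 L` with distinct residue characteristics, neither lying over `2`, at both of
which the base change to `L` of the curve `W` over `K` has good reduction, with `v ∈ 𝔭 ∩ 𝔮` and
`u, u + 1 ∉ 𝔭 ∪ 𝔮`. -/
def InfiniteOrderConditions {K K' : Type*} [Field K] [NumberField K] [Field K'] [NumberField K']
    [Algebra K K'] (W : WeierstrassCurve K) (u v : K') : Prop :=
  let L : IntermediateField K K' := IntermediateField.adjoin K {u, v}
  let uL : L := ⟨u, IntermediateField.subset_adjoin K {u, v} (Set.mem_insert u {v})⟩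
  let vL : L := ⟨v, IntermediateField.subset_adjoin K {u, v} (Set.mem_insert_of_mem u rfl)⟩
  ∃ 𝔭 𝔮 : HeightOneSpectrum (𝓞 L),
    𝔭.asIdeal.under ℤ ≠ 𝔮.asIdeal.under ℤ ∧
    ConditionsAt (W.baseChange L) uL vL 𝔭 ∧ ConditionsAt (W.baseChange L) uL vL 𝔮

/-- `u 0, …, u (n - 1)` are `n` distinct roots of `X ^ n - t` in `K'` (hence all of its roots), each
`v i` is a square root of `(u i ^ (n - 1) + 1) / (u i + 1)` in `K'`, and `P 0, …, P (n - 1)` are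
`n` distinct `K'`-rational points of the Legendre curve with parameter `t`, namely
`P i = (u i, u i * (u i + 1) * v i)`. -/
structure IsLegendrePointFamily {K K' : Type*} [Field K] [Field K'] [Algebra K K'] (t : K) (n : ℕ)
    (u v : Fin n → K') (P : Fin n → ((legendreCurve t).baseChange K').toAffine.Point) : Prop where
  root_injective : Function.Injective u
  root : ∀ i, u i ^ n = algebraMap K K' t
  sq : ∀ i, v i ^ 2 = (u i ^ (n - 1) + 1) / (u i + 1)
  point_injective : Function.Injective P
  point : ∀ i, ∃ h, P i = WeierstrassCurve.Affine.Point.some (u i) (u i * (u i + 1) * v i) h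

end

/-! Substituting λ = uⁿ turns x(x+1)(x+λ) at x = u into u²(u+1)(uⁿ⁻¹+1) = (u(u+1)v)². The points are
therefore rational wherever the u's and v's are, and these are radicals over K, so a splitting field
of the product of their minimal polynomials is a solvable extension containing them all. For
infinite order, work over L = K(u, v). At 𝔭 and 𝔮 the ordinate has valuation < 1, while u² - λ =
u(u+1)(1 - v²) is a unit. The duplication formula then gives 2P a pole at both primes, i.e. 2P lies
in both kernels of reduction. There z = x/y is additive up to cubic error, so such a kernel has no
l-torsion for l prime to its residue characteristic
(`IsIntegralTwoTorsionForm.eq_zero_of_nsmul_eq_zero`). The two characteristics differ, so if P is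
torsion then 2P = 0 and v = 0. The case v = 0 is excluded by the conditions at another root: n is
even, so -u is also a root, and its v' satisfies v'²(1 - u) = 2. This puts 2 in a prime not lying
over 2 (`IsLegendrePointFamily.v_ne_zero`). -/

/-! ### Solvable extensions generated by radicals. -/

open Polynomial in
/-- Finitely many elements that are solvable by radicals lie in a common finite Galois extension
with solvable Galois group. -/
theorem exists_isSolvable_extension (K : Type w) [Field K] [CharZero K]
    (s : Finset (AlgebraicClosure K)) (hs : ∀ x ∈ s, x ∈ solvableByRad K (AlgebraicClosure K)) :
    ∃ (K' : Type w) (_ : Field K') (_ : Algebra K K'),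
      FiniteDimensional K K' ∧ IsGalois K K' ∧ Group.IsSolvable Gal(K'/K) ∧
      ∃ φ : K' →ₐ[K] AlgebraicClosure K, ∀ x ∈ s, x ∈ φ.range := by
  classical
  set p : K[X] := (s.val.map (minpoly K)).prod with hp
  have hint : ∀ x ∈ s, IsIntegral K x := fun x hx ↦ isIntegral_of_mem_solvableByRad (hs x hx)
  have hp0 : p ≠ 0 := by
    rw [hp]
    refine Multiset.prod_ne_zero fun h ↦ ?_
    obtain ⟨x, hx, h0⟩ := Multiset.mem_map.1 h
    exact minpoly.ne_zero (hint x hx) h0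
  have hsolv : Group.IsSolvable p.Gal := by
    refine gal_prod_isSolvable fun q hq ↦ ?_
    obtain ⟨x, hx, rfl⟩ := Multiset.mem_map.1 hq
    exact isSolvable_gal_minpoly (hs x hx)
  let φ : p.SplittingField →ₐ[K] AlgebraicClosure K := IsAlgClosed.lift
  refine ⟨p.SplittingField, inferInstance, inferInstance, inferInstance, ⟨⟩, hsolv, φ,
    fun x hx ↦ ?_⟩
  have hroot : eval₂ (algebraMap K (AlgebraicClosure K)) x p = 0 := by
    obtain ⟨q, hq⟩ := Multiset.dvd_prod (Multiset.mem_map_of_mem (minpoly K) hx)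
    rw [hp, hq, eval₂_mul]
    have := minpoly.aeval K x
    rw [aeval_def] at this
    rw [this, zero_mul]
  have hmap : (p.map (algebraMap K p.SplittingField)).map φ.toRingHom =
      p.map (algebraMap K (AlgebraicClosure K)) := by
    rw [Polynomial.map_map]; congr 1; exact φ.comp_algebraMap
  have hsp := SplittingField.splits p
  have hroots := hsp.roots_map φ.toRingHom
  rw [hmap] at hroots
  have hx' : x ∈ (p.map (algebraMap K (AlgebraicClosure K))).roots := by
    rw [mem_roots (Polynomial.map_ne_zero hp0), IsRoot, eval_map, hroot]
  rw [hroots] at hx'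
  obtain ⟨z, -, hz⟩ := Multiset.mem_map.1 hx'
  exact ⟨z, hz⟩

/-! ### The Legendre curve and its points over a solvable extension. -/

theorem legendreCurve_Δ {F : Type*} [Field F] (t : F) :
    (legendreCurve t).Δ = 16 * t ^ 2 * (t - 1) ^ 2 := by
  simp only [WeierstrassCurve.Δ, WeierstrassCurve.b₂, WeierstrassCurve.b₄, WeierstrassCurve.b₆,
    WeierstrassCurve.b₈, legendreCurve]
  ring

theorem legendreCurve_baseChange {F F' : Type*} [Field F] [Field F'] [Algebra F F'] (t : F) :
    (legendreCurve t).baseChange F' = legendreCurve (algebraMap F F' t) := by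
  ext <;> simp [legendreCurve]

theorem legendreCurve_equation_iff {F : Type*} [Field F] (t x y : F) :
    (legendreCurve t).toAffine.Equation x y ↔ y ^ 2 = x ^ 3 + (1 + t) * x ^ 2 + t * x := by
  rw [WeierstrassCurve.Affine.equation_iff]
  simp [legendreCurve]

open Polynomial in
/-- The existence of a solvable extension over which the Legendre curve acquires the points with
`X`-coordinates the roots of `X ^ n - t`. -/
theorem exists_isLegendrePointFamily (K : Type w) [Field K] [CharZero K] (t : K) (ht0 : t ≠ 0)
    (ht1 : t ≠ 1) (n : ℕ) (hn : 0 < n) (hn_even : Even n) :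
    ∃ (K' : Type w) (_ : Field K') (_ : Algebra K K'),
      FiniteDimensional K K' ∧ IsGalois K K' ∧ Group.IsSolvable Gal(K'/K) ∧
      ∃ (u v : Fin n → K') (P : Fin n → ((legendreCurve t).baseChange K').toAffine.Point),
        IsLegendrePointFamily t n u v P := by
  classical
  set Ω := AlgebraicClosure K
  have htΩ : algebraMap K Ω t ≠ 0 := by simpa using ht0
  have hsep : (X ^ n - C (algebraMap K Ω t)).Separable :=
    separable_X_pow_sub_C _ (by exact_mod_cast hn.ne') htΩ
  have hcard : (nthRootsFinset n (algebraMap K Ω t)).card = n := by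
    rw [nthRootsFinset_def, Multiset.toFinset_card_of_nodup, nthRoots,
      ← (IsAlgClosed.splits _).natDegree_eq_card_roots, natDegree_X_pow_sub_C]
    exact nodup_roots hsep
  let e := (nthRootsFinset n (algebraMap K Ω t)).equivFinOfCardEq hcard
  let u : Fin n → Ω := fun i ↦ e.symm i
  have hu : ∀ i, u i ^ n = algebraMap K Ω t := fun i ↦
    (mem_nthRootsFinset hn _).1 (e.symm i).2
  have huinj : Function.Injective u := Subtype.val_injective.comp e.symm.injective
  choose v hv using fun i ↦ IsAlgClosed.exists_pow_nat_eq ((u i ^ (n - 1) + 1) / (u i + 1))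
    (zero_lt_two)
  have hus : ∀ i, u i ∈ solvableByRad K Ω := fun i ↦
    solvableByRad.rad_mem hn.ne' (by rw [hu i]; exact algebraMap_mem _ t)
  have hvs : ∀ i, v i ∈ solvableByRad K Ω := fun i ↦
    solvableByRad.rad_mem two_ne_zero (by
      rw [hv i]
      exact div_mem (add_mem (pow_mem (hus i) _) (one_mem _)) (add_mem (hus i) (one_mem _)))
  obtain ⟨K', _, _, hfin, hgal, hsolv, φ, hφ⟩ := exists_isSolvable_extension K
    (Finset.univ.image u ∪ Finset.univ.image v) (by
      intro x hx
      simp only [Finset.mem_union, Finset.mem_image, Finset.mem_univ, true_and] at hx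
      rcases hx with ⟨i, rfl⟩ | ⟨i, rfl⟩
      exacts [hus i, hvs i])
  choose u' hu' using fun i ↦ hφ (u i) (by simp)
  choose v' hv' using fun i ↦ hφ (v i) (by simp)
  have hφinj : Function.Injective φ := φ.injective
  replace hu' : ∀ i, φ (u' i) = u i := hu'
  replace hv' : ∀ i, φ (v' i) = v i := hv'
  have hroot : ∀ i, u' i ^ n = algebraMap K K' t := fun i ↦ hφinj (by
    rw [map_pow, hu', hu, AlgHom.commutes])
  have hsq : ∀ i, v' i ^ 2 = (u' i ^ (n - 1) + 1) / (u' i + 1) := fun i ↦ hφinj (by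
    simp [hu', hv', hv])
  have huinj' : Function.Injective u' := fun i j h ↦ huinj (by rw [← hu', ← hu', h])
  have hpt : ∀ i, ((legendreCurve t).baseChange K').toAffine.Nonsingular (u' i)
      (u' i * (u' i + 1) * v' i) := by
    intro i
    have hi := hsq i
    rw [legendreCurve_baseChange, ← hroot i]
    have h1 : u' i + 1 ≠ 0 := fun h ↦ ht1 <| (algebraMap K K').injective <| by
      rw [← hroot i, eq_neg_of_add_eq_zero_left h, hn_even.neg_one_pow, map_one]
    rw [← WeierstrassCurve.Affine.equation_iff_nonsingular_of_Δ_ne_zero,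
      legendreCurve_equation_iff]
    -- With t = uⁿ the cubic factors as u²(u+1)(uⁿ⁻¹+1).
    · rw [eq_div_iff h1] at hi
      obtain ⟨m, rfl⟩ : ∃ m, n = m + 1 := ⟨n - 1, by omega⟩
      rw [Nat.add_sub_cancel] at hi
      rw [pow_succ]
      linear_combination (u' i) ^ 2 * (u' i + 1) * hi
    · rw [legendreCurve_Δ, hroot i]
      have : CharZero K' := charZero_of_injective_algebraMap (algebraMap K K').injective
      refine mul_ne_zero (mul_ne_zero (by norm_num) (pow_ne_zero _ (by simpa using ht0)))
        (pow_ne_zero _ (sub_ne_zero.2 fun h ↦ ht1 ((algebraMap K K').injective (by simpa using h))))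
  exact ⟨K', _, _, hfin, hgal, hsolv, u', v', fun i ↦ .some _ _ (hpt i), huinj', hroot, hsq,
    fun i j h ↦ huinj' (WeierstrassCurve.Affine.Point.some.inj h).1, fun i ↦ ⟨_, rfl⟩⟩

/-! ### Valuation estimates near the origin of the curve. -/

section ValuationBounds

variable {F Γ₀ : Type*} [Field F] [LinearOrderedCommGroupWithZero Γ₀] (v : Valuation F Γ₀)

/-- Where x has a pole, the cubic term strictly dominates the other two. -/
theorem Valuation.map_sq_eq_map_pow_three {a b x y : F} (ha : v a ≤ 1) (hb : v b ≤ 1)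
    (h : y ^ 2 = x ^ 3 + a * x ^ 2 + b * x) (hx : 1 < v x) : v y ^ 2 = v x ^ 3 := by
  have hx0 : 0 < v x := zero_lt_one.trans hx
  have hxx : v x < v x ^ 2 := by
    rw [sq]; exact lt_mul_of_one_lt_left hx0 hx
  have hlt : v (a * x ^ 2 + b * x) < v (x ^ 3) := by
    have h3 : v x ^ 2 < v x ^ 3 := by
      rw [pow_succ (v x) 2]; exact lt_mul_of_one_lt_right (pow_pos hx0 2) hx
    refine v.map_add_lt ?_ ?_
    · rw [map_mul, map_pow, map_pow]
      exact (mul_le_of_le_one_left' ha).trans_lt h3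
    · rw [map_mul, map_pow]
      exact (mul_le_of_le_one_left' hb).trans_lt (hxx.trans h3)
  rw [← map_pow, h, add_assoc, v.map_add_eq_of_lt_left hlt, map_pow]

theorem Valuation.map_one_div_eq {a b x y : F} (ha : v a ≤ 1) (hb : v b ≤ 1)
    (h : y ^ 2 = x ^ 3 + a * x ^ 2 + b * x) (hx : 1 < v x) : v (1 / y) = v (x / y) ^ 3 := by
  have hsq := v.map_sq_eq_map_pow_three ha hb h hx
  have hy : v y ≠ 0 := fun h0 ↦ by
    rw [h0, zero_pow two_ne_zero] at hsq
    exact (pow_pos (zero_lt_one.trans hx) 3).ne hsq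
  rw [map_div₀, map_div₀, map_one, div_pow, ← hsq]
  field_simp

theorem Valuation.map_div_lt_one {a b x y : F} (ha : v a ≤ 1) (hb : v b ≤ 1)
    (h : y ^ 2 = x ^ 3 + a * x ^ 2 + b * x) (hx : 1 < v x) : v (x / y) < 1 := by
  have hsq := v.map_sq_eq_map_pow_three ha hb h hx
  by_contra! hle
  have h1 : 1 ≤ v (1 / y) := by
    rw [v.map_one_div_eq ha hb h hx]; exact one_le_pow₀ hle
  have hy : y ≠ 0 := by
    rintro rfl
    simp at h1
  have hy1 : v y ≤ 1 := by
    rw [map_div₀, map_one, one_div] at h1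
    exact (one_le_inv₀ ((Valuation.pos_iff v).2 hy)).1 h1
  have : v x ^ 3 ≤ 1 := hsq ▸ pow_le_one₀ zero_le hy1
  exact absurd this (not_le.2 (one_lt_pow₀ hx (by norm_num)))

/-- The chord construction near the origin of `y² = x³ + a x² + b x`, in the coordinates
`z = x / y` and `w = 1 / y`. The hypotheses say that the line `y = l x + c` meets the curve in the
points with `X`-coordinates `x₁`, `x₂` and `x₃`. -/
theorem Valuation.map_chord_le {a b x₁ y₁ x₂ y₂ x₃ y₃ l c : F} {r : Γ₀}
    (ha : v a ≤ 1) (hb : v b ≤ 1)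
    (h₁ : y₁ ^ 2 = x₁ ^ 3 + a * x₁ ^ 2 + b * x₁) (h₂ : y₂ ^ 2 = x₂ ^ 3 + a * x₂ ^ 2 + b * x₂)
    (hx₁ : 1 < v x₁) (hx₂ : 1 < v x₂) (hr : r < 1) (hz₁ : v (x₁ / y₁) ≤ r)
    (hz₂ : v (x₂ / y₂) ≤ r)
    (hl₁ : y₁ = l * x₁ + c) (hl₂ : y₂ = l * x₂ + c) (hl₃ : y₃ = l * x₃ + c)
    (he₁ : x₁ + x₂ + x₃ = l ^ 2 - a) (he₂ : x₁ * x₂ + x₁ * x₃ + x₂ * x₃ = b - 2 * l * c)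
    (he₃ : x₁ * x₂ * x₃ = c ^ 2)
    (hUV : l * (1 - a * (x₁ / y₁) ^ 2 - b * (x₂ / y₂) * (1 / y₁ + 1 / y₂)) +
      c * ((x₁ / y₁) ^ 2 + (x₁ / y₁) * (x₂ / y₂) + (x₂ / y₂) ^ 2 +
        a * (1 / y₂) * (x₁ / y₁ + x₂ / y₂) + b * (1 / y₁) ^ 2) = 0) :
    1 < v x₃ ∧ v (x₁ / y₁ + x₂ / y₂ + x₃ / y₃) ≤ r ^ 3 := by
  have hw₁ : v (1 / y₁) ≤ r ^ 3 := by
    rw [v.map_one_div_eq ha hb h₁ hx₁]; exact pow_le_pow_left' hz₁ 3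
  have hw₂ : v (1 / y₂) ≤ r ^ 3 := by
    rw [v.map_one_div_eq ha hb h₂ hx₂]; exact pow_le_pow_left' hz₂ 3
  have ne_zero : ∀ {x y : F}, y ^ 2 = x ^ 3 + a * x ^ 2 + b * x → 1 < v x → y ≠ 0 := by
    rintro x y h hx rfl
    have := v.map_sq_eq_map_pow_three ha hb h hx
    rw [map_zero, zero_pow two_ne_zero] at this
    exact (pow_pos (zero_lt_one.trans hx) 3).ne this
  have hy₁ := ne_zero h₁ hx₁
  have hy₂ := ne_zero h₂ hx₂
  have hrn : ∀ m n : ℕ, m ≤ n → r ^ n ≤ r ^ m := fun m n h ↦ pow_le_pow_right_of_le_one' hr.le h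
  have hr1 : ∀ n : ℕ, r ^ n ≤ 1 := fun n ↦ pow_le_one₀ zero_le hr.le
  have hr2 : r ^ 2 < 1 := pow_lt_one₀ zero_le hr two_ne_zero
  have hr3 : r ^ 3 ≤ r := by simpa using hrn 1 3 (by norm_num)
  have mul_le : ∀ {x y : F} {m n : ℕ}, v x ≤ r ^ m → v y ≤ r ^ n → v (x * y) ≤ r ^ (m + n) :=
    fun hx hy ↦ by rw [map_mul, pow_add]; exact mul_le_mul' hx hy
  have mul_le' : ∀ {x y : F} {n : ℕ}, v x ≤ 1 → v y ≤ r ^ n → v (x * y) ≤ r ^ n :=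
    fun hx hy ↦ by rw [map_mul]; exact (mul_le_of_le_one_left' hx).trans hy
  have weaken : ∀ {x : F} {n : ℕ} (m : ℕ), v x ≤ r ^ n → m ≤ n → v x ≤ r ^ m :=
    fun m hx hmn ↦ hx.trans (hrn _ _ hmn)
  set z₁ := x₁ / y₁ with hz₁_def
  set z₂ := x₂ / y₂ with hz₂_def
  set w₁ := 1 / y₁ with hw₁_def
  set w₂ := 1 / y₂ with hw₂_def
  replace hz₁ : v z₁ ≤ r ^ 1 := by simpa using hz₁
  replace hz₂ : v z₂ ≤ r ^ 1 := by simpa using hz₂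
  set U := 1 - a * z₁ ^ 2 - b * z₂ * (w₁ + w₂) with hU_def
  set V := z₁ ^ 2 + z₁ * z₂ + z₂ ^ 2 + a * w₂ * (z₁ + z₂) + b * w₁ ^ 2 with hV_def
  -- In these coordinates the curve is w = z³ + a z² w + b z w². Subtracting its equations at two
  -- points gives (w₁ - w₂) U = (z₁ - z₂) V, so V / U is the slope of the chord; `hUV` states this
  -- in a form that also covers tangents.
  have hU : v U = 1 := by
    have : v (a * z₁ ^ 2 + b * (z₂ * (w₁ + w₂))) < 1 := by
      refine lt_of_le_of_lt (v.map_add_le ?_ ?_) hr2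
      · rw [sq]; exact mul_le' ha (mul_le hz₁ hz₁)
      · exact mul_le' hb (weaken 2 (mul_le hz₂ (v.map_add_le hw₁ hw₂)) (by norm_num))
    rw [hU_def, show 1 - a * z₁ ^ 2 - b * z₂ * (w₁ + w₂) =
      1 - (a * z₁ ^ 2 + b * (z₂ * (w₁ + w₂))) by ring]
    exact v.map_one_sub_of_lt this
  have hV : v V ≤ r ^ 2 := by
    refine v.map_add_le (v.map_add_le (v.map_add_le (v.map_add_le ?_ ?_) ?_) ?_) ?_
    · rw [sq]; exact mul_le hz₁ hz₁
    · exact mul_le hz₁ hz₂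
    · rw [sq]; exact mul_le hz₂ hz₂
    · exact weaken 2 (mul_le (mul_le' ha hw₂) (v.map_add_le hz₁ hz₂)) (by norm_num)
    · rw [sq]; exact weaken 2 (mul_le' hb (mul_le hw₁ hw₁)) (by norm_num)
  have hU0 : U ≠ 0 := (Valuation.ne_zero_iff v).1 (by rw [hU]; exact one_ne_zero)
  have hc : c ≠ 0 := by
    rintro rfl
    rw [zero_mul, add_zero] at hUV
    have hl : l = 0 := (mul_eq_zero.1 hUV).resolve_right hU0
    exact hy₁ (by rw [hl₁, hl]; ring)
  -- The line y = l x + c reads w = α z + β.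
  set α := -l / c with hα_def
  set β := 1 / c with hβ_def
  have hαU : α * U = V := by
    rw [hα_def]; field_simp; linear_combination -hUV
  have hα : v α ≤ r ^ 2 := by
    rw [← hαU, map_mul, hU, mul_one] at hV; exact hV
  have hβ_eq : β = w₁ - α * z₁ := by
    rw [hβ_def, hα_def, hw₁_def, hz₁_def]; field_simp; rw [hl₁]; ring
  have hβ : v β ≤ r ^ 3 := by
    rw [hβ_eq]; exact v.map_sub_le hw₁ (mul_le hα hz₁)
  -- Substituting w = α z + β in the curve gives a cubic in z with leading coefficient D and
  -- z²-coefficient aβ + 2bαβ; Vieta then yields `hsum`.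
  set D := 1 + a * α + b * α ^ 2 with hD_def
  have hD : v D = 1 := by
    rw [hD_def, add_assoc]
    refine v.map_one_add_of_lt (lt_of_le_of_lt (v.map_add_le (mul_le' ha hα) ?_) hr2)
    rw [sq]; exact mul_le' hb (weaken 2 (mul_le hα hα) (by norm_num))
  have hD0 : D ≠ 0 := (Valuation.ne_zero_iff v).1 (by rw [hD]; exact one_ne_zero)
  have hDc : c ^ 3 * D = c * (c ^ 2 - a * l * c + b * l ^ 2) := by
    rw [hD_def, hα_def]; field_simp; ring
  have hprod : y₁ * y₂ * y₃ = c ^ 3 * D := by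
    rw [hDc, hl₁, hl₂, hl₃]
    linear_combination l ^ 3 * he₃ + l ^ 2 * c * he₂ + l * c ^ 2 * he₁
  have hy₃ : y₃ ≠ 0 := fun h ↦ by
    rw [h, mul_zero] at hprod
    exact mul_ne_zero (pow_ne_zero 3 hc) hD0 hprod.symm
  have hsum : z₁ + z₂ + x₃ / y₃ = -(a * β + b * (α * β) + b * (α * β)) / D := by
    have hnum : x₁ * y₂ * y₃ + x₂ * y₁ * y₃ + x₃ * y₁ * y₂ = 2 * c * l * b - a * c ^ 2 := by
      rw [hl₁, hl₂, hl₃]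
      linear_combination 3 * l ^ 2 * he₃ + 2 * c * l * he₂ + c ^ 2 * he₁
    have hlhs : z₁ + z₂ + x₃ / y₃ = (2 * c * l * b - a * c ^ 2) / (c ^ 3 * D) := by
      rw [← hprod, ← hnum, hz₁_def, hz₂_def]; field_simp
    rw [hlhs, div_eq_div_iff (mul_ne_zero (pow_ne_zero 3 hc) hD0) hD0, hα_def, hβ_def]
    field_simp; ring
  have hsum_le : v (z₁ + z₂ + x₃ / y₃) ≤ r ^ 3 := by
    rw [hsum, map_div₀, hD, div_one, Valuation.map_neg]
    have h5 : v (b * (α * β)) ≤ r ^ 3 :=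
      mul_le' hb (weaken 3 (mul_le hα hβ) (by norm_num))
    exact v.map_add_le (v.map_add_le (mul_le' ha hβ) h5) h5
  refine ⟨?_, hsum_le⟩
  have hz₃ : v (x₃ / y₃) ≤ r ^ 1 := by
    have : x₃ / y₃ = z₁ + z₂ + x₃ / y₃ - (z₁ + z₂) := by ring
    rw [this]
    exact v.map_sub_le (weaken 1 hsum_le (by norm_num)) (v.map_add_le hz₁ hz₂)
  have hw₃ : v (1 / y₃) < 1 := by
    have : 1 / y₃ = α * (x₃ / y₃) + β := by
      rw [hα_def, hβ_def]; field_simp; rw [hl₃]; ring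
    rw [this]
    exact (v.map_add_le (mul_le hα hz₃) hβ).trans_lt (hr3.trans_lt hr)
  have h₃ : y₃ ^ 2 = x₃ ^ 3 + a * x₃ ^ 2 + b * x₃ := by
    rw [hl₃]
    linear_combination -he₃ + x₃ * he₂ - x₃ ^ 2 * he₁
  -- `hw₃` says that y₃ has a pole; integral x₃ would make y₃ integral.
  by_contra! hle
  have hy : v (y₃ ^ 2) ≤ 1 := by
    have hp : ∀ n : ℕ, v (x₃ ^ n) ≤ 1 := fun n ↦ by
      rw [map_pow]; exact pow_le_one₀ zero_le hle
    rw [h₃]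
    refine v.map_add_le (v.map_add_le (hp 3) ?_) ?_
    · rw [map_mul]; exact mul_le_one' ha (hp 2)
    · rw [map_mul]; exact mul_le_one' hb hle
  rw [map_div₀, map_one, one_div, inv_lt_one₀ ((Valuation.pos_iff v).2 hy₃)] at hw₃
  rw [map_pow] at hy
  exact absurd hy (not_le.2 (one_lt_pow₀ hw₃ two_ne_zero))

end ValuationBounds

/-! ### The kernel of reduction and its torsion. -/

section KernelOfReduction

open WeierstrassCurve.Affine

variable {F Γ₀ : Type*} [Field F] [LinearOrderedCommGroupWithZero Γ₀]

/-- A Weierstrass equation `y² = x³ + a x² + b x` whose coefficients are integral for `v`. -/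
structure IsIntegralTwoTorsionForm (v : Valuation F Γ₀) (W : WeierstrassCurve F) : Prop where
  a₁ : W.a₁ = 0
  a₃ : W.a₃ = 0
  a₆ : W.a₆ = 0
  map_a₂_le : v W.a₂ ≤ 1
  map_a₄_le : v W.a₄ ≤ 1

/-- The local parameter `x / y` at the origin. -/
def pointParameter {W : WeierstrassCurve F} : W.toAffine.Point → F
  | .zero => 0
  | .some x y _ => x / y

/-- The point lies in the kernel of reduction for the valuation `v`. -/
def ReducesToZero (v : Valuation F Γ₀) {W : WeierstrassCurve F} : W.toAffine.Point → Prop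
  | .zero => True
  | .some x _ _ => 1 < v x

variable {v : Valuation F Γ₀} {W : WeierstrassCurve F}

theorem IsIntegralTwoTorsionForm.equation (hW : IsIntegralTwoTorsionForm v W) {x y : F}
    (h : W.toAffine.Nonsingular x y) : y ^ 2 = x ^ 3 + W.a₂ * x ^ 2 + W.a₄ * x := by
  have := (equation_iff ..).1 h.1
  simpa [hW.a₁, hW.a₃, hW.a₆] using this

theorem IsIntegralTwoTorsionForm.negY_eq (hW : IsIntegralTwoTorsionForm v W) (x y : F) :
    W.toAffine.negY x y = -y := by
  simp [negY, hW.a₁, hW.a₃]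

theorem IsIntegralTwoTorsionForm.y_ne_zero (hW : IsIntegralTwoTorsionForm v W) {x y : F}
    (h : W.toAffine.Nonsingular x y) (hx : 1 < v x) : y ≠ 0 := by
  rintro rfl
  have := v.map_sq_eq_map_pow_three hW.map_a₂_le hW.map_a₄_le (hW.equation h) hx
  rw [map_zero, zero_pow two_ne_zero] at this
  exact (pow_pos (zero_lt_one.trans hx) 3).ne this

theorem IsIntegralTwoTorsionForm.pointParameter_lt_one (hW : IsIntegralTwoTorsionForm v W)
    {P : W.toAffine.Point} (hP : ReducesToZero v P) : v (pointParameter P) < 1 := by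
  rcases P with _ | ⟨x, y, h⟩
  · simp [pointParameter]
  · exact v.map_div_lt_one hW.map_a₂_le hW.map_a₄_le (hW.equation h) hP

variable [DecidableEq F]

/-- The formal group law has no quadratic term because `a₁ = a₃ = 0`, hence the cubic error. The
third point on the chord is -(P + Q), with parameter opposite to that of P + Q, so
`Valuation.map_chord_le` applies. -/
theorem IsIntegralTwoTorsionForm.add (hW : IsIntegralTwoTorsionForm v W) {r : Γ₀} (hr : r < 1)
    {P Q : W.toAffine.Point} (hP : ReducesToZero v P) (hQ : ReducesToZero v Q)
    (hPr : v (pointParameter P) ≤ r) (hQr : v (pointParameter Q) ≤ r) :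
    ReducesToZero v (P + Q) ∧
      v (pointParameter (P + Q) - (pointParameter P + pointParameter Q)) ≤ r ^ 3 := by
  rcases P with _ | ⟨x₁, y₁, h₁⟩
  · rw [← Point.zero_def, zero_add]
    exact ⟨hQ, by simp [pointParameter]⟩
  rcases Q with _ | ⟨x₂, y₂, h₂⟩
  · rw [← Point.zero_def, add_zero]
    exact ⟨hP, by simp [pointParameter]⟩
  by_cases hxy : x₁ = x₂ ∧ y₁ = W.toAffine.negY x₂ y₂
  · rw [Point.add_of_Y_eq hxy.1 hxy.2]
    refine ⟨trivial, ?_⟩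
    have : x₁ / y₁ + x₂ / y₂ = 0 := by rw [hxy.1, hxy.2, hW.negY_eq, div_neg]; ring
    change v (0 - (x₁ / y₁ + x₂ / y₂)) ≤ r ^ 3
    simp [this]
  have e₁ := hW.equation h₁
  have e₂ := hW.equation h₂
  have hy₁ := hW.y_ne_zero h₁ hP
  have hy₂ := hW.y_ne_zero h₂ hQ
  rw [Point.add_some hxy]
  set l := W.toAffine.slope x₁ x₂ y₁ y₂ with hl_def
  have hX : W.toAffine.addX x₁ x₂ l = l ^ 2 - W.a₂ - x₁ - x₂ := by simp [addX, hW.a₁]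
  have hY : W.toAffine.addY x₁ x₂ y₁ l =
      -(l * W.toAffine.addX x₁ x₂ l + (y₁ - l * x₁)) := by
    rw [addY, hW.negY_eq, negAddY]; ring
  change 1 < v (W.toAffine.addX x₁ x₂ l) ∧
    v (W.toAffine.addX x₁ x₂ l / W.toAffine.addY x₁ x₂ y₁ l - (x₁ / y₁ + x₂ / y₂)) ≤ r ^ 3
  set x₃ := W.toAffine.addX x₁ x₂ l
  rw [hY, div_neg, ← v.map_neg (_ - _),
    show -(-(x₃ / (l * x₃ + (y₁ - l * x₁))) - (x₁ / y₁ + x₂ / y₂)) =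
      x₁ / y₁ + x₂ / y₂ + x₃ / (l * x₃ + (y₁ - l * x₁)) by ring]
  by_cases hx : x₁ = x₂
  · have hy : y₁ ≠ -y₂ := fun h ↦ hxy ⟨hx, by rw [hW.negY_eq, h]⟩
    obtain rfl : y₁ = y₂ := by
      subst hx
      have : (y₁ - y₂) * (y₁ + y₂) = 0 := by linear_combination e₁ - e₂
      rcases mul_eq_zero.1 this with h | h
      · exact sub_eq_zero.1 h
      · exact absurd (eq_neg_of_add_eq_zero_left h) hy
    have h2y : 2 * y₁ ≠ 0 := fun h ↦ hy (by linear_combination h)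
    have hl : l * (2 * y₁) = 3 * x₁ ^ 2 + 2 * W.a₂ * x₁ + W.a₄ := by
      rw [hl_def, slope_of_Y_ne hx (by rwa [hW.negY_eq]), hW.negY_eq, hW.a₁, sub_neg_eq_add,
        ← two_mul, div_mul_cancel₀ _ h2y]
      ring
    subst hx
    refine v.map_chord_le (l := l) (c := y₁ - l * x₁) hW.map_a₂_le hW.map_a₄_le e₁ e₁ hP hP hr
      hPr hPr (by ring) (by ring) rfl (by rw [hX]; ring) ?_ ?_ ?_
    · rw [hX]; linear_combination hl
    · rw [hX]; linear_combination x₁ * hl - e₁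
    -- For the tangent, the slope relation is checked after clearing the denominator 2y₁ of l; for a
    -- chord, x₁ - x₂ plays this role.
    · have h2 : (2 : F) ≠ 0 := left_ne_zero_of_mul h2y
      refine mul_left_cancel₀ h2y ?_
      have hc : 2 * y₁ * (y₁ - l * x₁) = W.a₄ * x₁ - x₁ ^ 3 := by
        linear_combination 2 * e₁ - x₁ * hl
      have hU : 1 - W.a₂ * (x₁ / y₁) ^ 2 - W.a₄ * (x₁ / y₁) * (1 / y₁ + 1 / y₁) =
          (x₁ ^ 3 - W.a₄ * x₁) / y₁ ^ 2 := by
        field_simp; linear_combination e₁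
      have hV : (x₁ / y₁) ^ 2 + (x₁ / y₁) * (x₁ / y₁) + (x₁ / y₁) ^ 2 +
          W.a₂ * (1 / y₁) * (x₁ / y₁ + x₁ / y₁) + W.a₄ * (1 / y₁) ^ 2 =
          (3 * x₁ ^ 2 + 2 * W.a₂ * x₁ + W.a₄) / y₁ ^ 2 := by
        field_simp; ring
      rw [hU, hV, mul_add, ← mul_assoc, ← mul_assoc, hc, mul_comm (2 * y₁) l, hl]
      ring
  · have hxs : x₁ - x₂ ≠ 0 := sub_ne_zero.2 hx
    have hl : l * (x₁ - x₂) = y₁ - y₂ := by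
      rw [hl_def, slope_of_X_ne hx, div_mul_cancel₀ _ hxs]
    have hs : l * (y₁ + y₂) = x₁ ^ 2 + x₁ * x₂ + x₂ ^ 2 + W.a₂ * (x₁ + x₂) + W.a₄ := by
      refine mul_left_cancel₀ hxs ?_
      linear_combination (y₁ + y₂) * hl + e₁ - e₂
    refine v.map_chord_le (l := l) (c := y₁ - l * x₁) hW.map_a₂_le hW.map_a₄_le e₁ e₂ hP hQ hr
      hPr hQr (by ring) (by linear_combination hl) rfl (by rw [hX]; ring) ?_ ?_ ?_
    · rw [hX]; linear_combination hs - l * hl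
    · rw [hX]; linear_combination x₁ * hs - x₁ * l * hl - e₁
    · refine mul_left_cancel₀ hxs ?_
      have hc : (x₁ - x₂) * (y₁ - l * x₁) = x₁ * y₂ - x₂ * y₁ := by
        linear_combination -x₁ * hl
      rw [mul_zero, mul_add, ← mul_assoc, ← mul_assoc, hc, mul_comm (x₁ - x₂) l, hl]
      field_simp
      linear_combination y₁ ^ 3 * e₂ - y₂ ^ 3 * e₁

/-- Each addition introduces a cubic error, and the ultrametric inequality keeps these errors from
accumulating. -/
theorem IsIntegralTwoTorsionForm.nsmul (hW : IsIntegralTwoTorsionForm v W)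
    {P : W.toAffine.Point} (hP : ReducesToZero v P) (m : ℕ) :
    ReducesToZero v (m • P) ∧ v (pointParameter (m • P)) ≤ v (pointParameter P) ∧
      v (pointParameter (m • P) - m * pointParameter P) ≤ v (pointParameter P) ^ 3 := by
  have hr := hW.pointParameter_lt_one hP
  induction m with
  | zero =>
    rw [zero_nsmul]
    exact ⟨trivial, by simp [pointParameter], by simp [pointParameter]⟩
  | succ m ih =>
    obtain ⟨h1, h2, h3⟩ := ih
    obtain ⟨h4, h5⟩ := hW.add hr h1 hP h2 le_rfl
    rw [succ_nsmul]
    set z := pointParameter P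
    set z' := pointParameter (m • P)
    set z'' := pointParameter (m • P + P)
    have hle : v z ^ 3 ≤ v z := pow_le_of_le_one zero_le hr.le three_ne_zero
    refine ⟨h4, ?_, ?_⟩
    · rw [show z'' = z'' - (z' + z) + (z' + z) by ring]
      exact v.map_add_le (h5.trans hle) (v.map_add_le h2 le_rfl)
    · rw [show z'' - ((m + 1 : ℕ) : F) * z = z'' - (z' + z) + (z' - m * z) by push_cast; ring]
      exact v.map_add_le h5 h3

/-- The kernel of reduction has no torsion of order a unit for the valuation. -/
theorem IsIntegralTwoTorsionForm.eq_zero_of_nsmul_eq_zero (hW : IsIntegralTwoTorsionForm v W)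
    {P : W.toAffine.Point} (hP : ReducesToZero v P) {m : ℕ} (hm : v (m : F) = 1)
    (h : m • P = 0) : P = 0 := by
  have hr := hW.pointParameter_lt_one hP
  have h3 := (hW.nsmul hP m).2.2
  -- Since mP has parameter 0, the estimate becomes v(z) ≤ v(z)³, impossible for 0 < v(z) < 1.
  rw [h, Point.zero_def] at h3
  change v (0 - _) ≤ _ at h3
  rw [zero_sub, Valuation.map_neg, map_mul, hm, one_mul] at h3
  rcases P with _ | ⟨x, y, hxy⟩
  · rfl
  have hx : x ≠ 0 := by
    rintro rfl
    have : (1 : Γ₀) < v 0 := hP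
    simp at this
  have hz : pointParameter (Point.some x y hxy) ≠ 0 := div_ne_zero hx (hW.y_ne_zero hxy hP)
  have hpos := (Valuation.pos_iff v).2 hz
  exact absurd h3 (not_le.2 (pow_lt_self_of_lt_one₀ hpos hr (by norm_num)))

/-- A torsion point that lies in the kernel of reduction for two valuations with different residue
characteristics is zero. -/
theorem IsIntegralTwoTorsionForm.eq_zero_of_isOfFinAddOrder {v' : Valuation F Γ₀}
    (hW : IsIntegralTwoTorsionForm v W) (hW' : IsIntegralTwoTorsionForm v' W)
    (hvv' : ∀ l : ℕ, l.Prime → v (l : F) = 1 ∨ v' (l : F) = 1)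
    {P : W.toAffine.Point} (hP : ReducesToZero v P) (hP' : ReducesToZero v' P)
    (h : IsOfFinAddOrder P) : P = 0 := by
  by_contra hP0
  obtain ⟨l, hl, k, hk⟩ := Nat.exists_prime_and_dvd (mt AddMonoid.addOrderOf_eq_one_iff.1 hP0)
  have hpos := h.addOrderOf_pos
  -- With l a prime factor of the order lk of P, the multiple kP is killed by l and lies in both
  -- kernels; l is a unit for one of the valuations.
  have hlk : l • (k • P) = 0 := by
    rw [← mul_nsmul', ← hk, addOrderOf_nsmul_eq_zero]
  have hk0 : k • P = 0 := by
    rcases hvv' l hl with h1 | h1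
    · exact hW.eq_zero_of_nsmul_eq_zero (hW.nsmul hP k).1 h1 hlk
    · exact hW'.eq_zero_of_nsmul_eq_zero (hW'.nsmul hP' k).1 h1 hlk
  have hkpos : 0 < k := Nat.pos_of_mul_pos_left (hk ▸ hpos)
  have := Nat.le_of_dvd hkpos (addOrderOf_dvd_of_nsmul_eq_zero hk0)
  rw [hk] at this
  nlinarith [hl.two_le]

/-- If a point reduces to a nonsingular point of order two then its double reduces to zero. -/
theorem IsIntegralTwoTorsionForm.reducesToZero_add_self (hW : IsIntegralTwoTorsionForm v W)
    {x y : F} (h : W.toAffine.Nonsingular x y) (hy : v y < 1) (hx : v (x ^ 2 - W.a₄) = 1) :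
    ReducesToZero v (Point.some x y h + Point.some x y h) := by
  by_cases hyy : y = W.toAffine.negY x y
  · rw [Point.add_self_of_Y_eq hyy]; trivial
  rw [Point.add_self_of_Y_ne hyy]
  set l := W.toAffine.slope x x y y with hl_def
  change 1 < v (W.toAffine.addX x x l)
  have hX : W.toAffine.addX x x l = l ^ 2 - W.a₂ - x - x := by simp [addX, hW.a₁]
  have h2y : 2 * y ≠ 0 := fun h0 ↦ hyy (by rw [hW.negY_eq]; linear_combination h0)
  have hl : l * (2 * y) = 3 * x ^ 2 + 2 * W.a₂ * x + W.a₄ := by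
    rw [hl_def, slope_of_Y_ne rfl hyy, hW.negY_eq, hW.a₁, sub_neg_eq_add,
      ← two_mul, div_mul_cancel₀ _ h2y]
    ring
  -- Duplication formula: the right side is a unit and 2y is not, so x(2P) has a pole.
  have key : W.toAffine.addX x x l * (2 * y) ^ 2 = (x ^ 2 - W.a₄) ^ 2 := by
    rw [hX]
    linear_combination (l * (2 * y) + (3 * x ^ 2 + 2 * W.a₂ * x + W.a₄)) * hl -
      (4 * W.a₂ + 8 * x) * hW.equation h
  have h2 : v (2 * y) < 1 := by rw [two_mul]; exact v.map_add_lt hy hy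
  have hv := congrArg v key
  rw [map_mul, map_pow, map_pow, hx, one_pow] at hv
  by_contra! hle
  exact absurd hv (mul_lt_one_of_nonneg_of_lt_one_right hle zero_le
    (pow_lt_one₀ zero_le h2 two_ne_zero)).ne

end KernelOfReduction

/-! ### Valuations at primes of a number field. -/

section NumberField

variable {L : Type*} [Field L] [NumberField L]

theorem valuation_natCast_eq_one_or_under_eq (𝔭 : HeightOneSpectrum (𝓞 L)) {l : ℕ}
    (hl : l.Prime) : 𝔭.valuation L (l : L) = 1 ∨ 𝔭.asIdeal.under ℤ = Ideal.span {(l : ℤ)} := by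
  have hcast : (l : L) = algebraMap (𝓞 L) L (l : 𝓞 L) := by simp
  rw [hcast, HeightOneSpectrum.valuation_eq_one_iff_notMem]
  refine or_iff_not_imp_left.2 fun h ↦ ?_
  rw [not_not] at h
  have hmax : (Ideal.span {(l : ℤ)}).IsMaximal :=
    PrincipalIdealRing.isMaximal_of_irreducible (Nat.prime_iff_prime_int.1 hl).irreducible
  refine (hmax.eq_of_le (Ideal.IsPrime.under ℤ 𝔭.asIdeal).ne_top ?_).symm
  rw [Ideal.span_singleton_le_iff_mem, Ideal.under_def, Ideal.mem_comap]
  simpa using h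

theorem LiesIn.valuation_lt_one {x : L} {𝔭 : HeightOneSpectrum (𝓞 L)}
    (h : LiesIn x 𝔭.asIdeal) : 𝔭.valuation L x < 1 := by
  obtain ⟨a, ha, rfl⟩ := h
  exact (𝔭.valuation_lt_one_iff_mem a).2 ha

theorem IsIntegral.valuation_le_one {x : L} (hx : IsIntegral ℤ x)
    (𝔭 : HeightOneSpectrum (𝓞 L)) : 𝔭.valuation L x ≤ 1 :=
  𝔭.valuation_le_one (⟨x, hx⟩ : 𝓞 L)

theorem IsIntegral.valuation_eq_one {x : L} (hx : IsIntegral ℤ x) {𝔭 : HeightOneSpectrum (𝓞 L)}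
    (h : ¬ LiesIn x 𝔭.asIdeal) : 𝔭.valuation L x = 1 :=
  (𝔭.valuation_eq_one_iff_notMem (r := ⟨x, hx⟩)).2
    fun hmem : (⟨x, hx⟩ : 𝓞 L) ∈ 𝔭.asIdeal ↦ h ⟨_, hmem, rfl⟩

theorem isIntegralTwoTorsionForm_legendreCurve {K : Type*} [Field K] [NumberField K]
    [Algebra K L] {t : K} (ht : IsIntegral ℤ t) (𝔭 : HeightOneSpectrum (𝓞 L)) :
    IsIntegralTwoTorsionForm (𝔭.valuation L) ((legendreCurve t).baseChange L) := by
  have h : 𝔭.valuation L (algebraMap K L t) ≤ 1 :=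
    (ht.algebraMap (A := K) (B := L)).valuation_le_one 𝔭
  rw [legendreCurve_baseChange]
  exact ⟨rfl, rfl, rfl, Valuation.map_add_le _ (map_one _).le h, h⟩

variable {W : WeierstrassCurve L} {u v t : L} {n : ℕ} {𝔭 : HeightOneSpectrum (𝓞 L)}

theorem ConditionsAt.valuation_sq_sub_eq_one (h : ConditionsAt W u v 𝔭) (ht : IsIntegral ℤ t)
    (hn : 0 < n) (hu : u ^ n = t) (hv : v ^ 2 * (u + 1) = u ^ (n - 1) + 1) :
    𝔭.valuation L (u ^ 2 - t) = 1 ∧ 𝔭.valuation L (u * (u + 1) * v) < 1 := by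
  have hint : IsIntegral ℤ u := IsIntegral.of_pow hn (hu ▸ ht)
  have h1 := hint.valuation_eq_one h.u_notMem
  have h2 := (hint.add isIntegral_one).valuation_eq_one h.u_add_one_notMem
  have h3 := h.v_mem.valuation_lt_one
  have h4 : 𝔭.valuation L (1 - v ^ 2) = 1 := by
    refine Valuation.map_one_sub_of_lt _ ?_
    rw [map_pow]; exact pow_lt_one₀ zero_le h3 two_ne_zero
  refine ⟨?_, by rwa [map_mul, map_mul, h1, h2, one_mul, one_mul]⟩
  have : u ^ 2 - t = u * (u + 1) * (1 - v ^ 2) := by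
    obtain ⟨m, rfl⟩ : ∃ m, n = m + 1 := ⟨n - 1, by omega⟩
    rw [Nat.add_sub_cancel] at hv
    rw [← hu, pow_succ]
    linear_combination u * hv
  rw [this, map_mul, map_mul, h1, h2, h4, one_mul, one_mul]

/-- The left side lies in 𝔭, but 2 does not. This rules out the value forced at the root -u when the
ordinate at u vanishes. -/
theorem ConditionsAt.sq_mul_ne_two (h : ConditionsAt W u v 𝔭) (hn : 0 < n)
    (hu : IsIntegral ℤ (u ^ n)) : v ^ 2 * (u + 1) ≠ 2 := by
  intro h2
  have hint : IsIntegral ℤ u := IsIntegral.of_pow hn hu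
  have hlt : 𝔭.valuation L ((2 : ℕ) : L) < 1 := by
    rw [Nat.cast_ofNat, ← h2, map_mul, map_pow]
    exact mul_lt_one_of_nonneg_of_lt_one_left zero_le
      (pow_lt_one₀ zero_le h.v_mem.valuation_lt_one two_ne_zero)
      ((hint.add isIntegral_one).valuation_le_one 𝔭)
  rcases valuation_natCast_eq_one_or_under_eq 𝔭 Nat.prime_two with h' | h'
  · exact hlt.ne h'
  · exact h.not_over_two h'

end NumberField

/-! ### Algebra of the family of roots. -/

section LegendreFamily

variable {K K' : Type*} [Field K] [Field K'] [Algebra K K'] {t : K} {n : ℕ} {u v : Fin n → K'}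
  {P : Fin n → ((legendreCurve t).baseChange K').toAffine.Point}

theorem IsLegendrePointFamily.add_one_ne_zero (h : IsLegendrePointFamily t n u v P)
    (ht1 : t ≠ 1) (hn_even : Even n) (i : Fin n) : u i + 1 ≠ 0 := fun h0 ↦
  ht1 <| (algebraMap K K').injective <| by
    rw [← h.root i, eq_neg_of_add_eq_zero_left h0, hn_even.neg_one_pow, map_one]

theorem IsLegendrePointFamily.ne_zero (h : IsLegendrePointFamily t n u v P)
    (ht0 : t ≠ 0) (i : Fin n) : u i ≠ 0 := fun h0 ↦
  ht0 <| (algebraMap K K').injective <| by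
    rw [← h.root i, h0, zero_pow i.pos.ne', map_zero]

theorem IsLegendrePointFamily.sq_mul (h : IsLegendrePointFamily t n u v P)
    (ht1 : t ≠ 1) (hn_even : Even n) (i : Fin n) :
    v i ^ 2 * (u i + 1) = u i ^ (n - 1) + 1 := by
  rw [h.sq i, div_mul_cancel₀ _ (h.add_one_ne_zero ht1 hn_even i)]

open Polynomial in
-- The n distinct u's exhaust the roots of Xⁿ - t, a set stable under negation for even n.
theorem IsLegendrePointFamily.exists_eq_neg (h : IsLegendrePointFamily t n u v P)
    (hn_even : Even n) (i : Fin n) : ∃ j, u j = -u i := by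
  classical
  have hn : 0 < n := i.pos
  have hsub : Finset.univ.image u ⊆ nthRootsFinset n (algebraMap K K' t) := by
    intro x hx
    obtain ⟨j, -, rfl⟩ := Finset.mem_image.1 hx
    exact (mem_nthRootsFinset hn _).2 (h.root j)
  have hcard : (nthRootsFinset n (algebraMap K K' t)).card ≤ (Finset.univ.image u).card := by
    rw [Finset.card_image_of_injective _ h.root_injective, Finset.card_univ, Fintype.card_fin,
      nthRootsFinset_def]
    exact (Multiset.toFinset_card_le _).trans (card_nthRoots _ _)
  have hmem : -u i ∈ Finset.univ.image u := by
    rw [Finset.eq_of_subset_of_card_le hsub hcard, mem_nthRootsFinset hn, hn_even.neg_pow,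
      h.root]
  simpa using hmem

end LegendreFamily

/-! ### Infinite order of the points. -/

section InfiniteOrder

open WeierstrassCurve.Affine

variable {K K' : Type*} [Field K] [NumberField K] [Field K'] [NumberField K'] [Algebra K K']
  {t : K} {n : ℕ} {u v : Fin n → K'} {P : Fin n → ((legendreCurve t).baseChange K').toAffine.Point}

/-- Under the reduction conditions at all roots no ordinate vanishes. -/
theorem IsLegendrePointFamily.v_ne_zero (h : IsLegendrePointFamily t n u v P)
    (ht : IsIntegral ℤ t) (ht1 : t ≠ 1) (hn_even : Even n)
    (hcond : ∀ i, InfiniteOrderConditions (legendreCurve t) (u i) (v i)) (i : Fin n) :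
    v i ≠ 0 := by
  intro hv
  have hn : 0 < n := i.pos
  obtain ⟨j, hj⟩ := h.exists_eq_neg hn_even i
  have hi := h.sq_mul ht1 hn_even i
  have hsq := h.sq_mul ht1 hn_even j
  have hodd : Odd (n - 1) := Nat.Even.sub_odd hn hn_even odd_one
  -- Vanishing of v i means u iⁿ⁻¹ = -1; as n - 1 is odd, the opposite root has (n-1)-st power 1.
  have h2 : v j ^ 2 * (u j + 1) = 2 := by
    rw [hsq, hj, hodd.neg_pow]
    rw [hv] at hi
    linear_combination hi
  obtain ⟨𝔭, -, -, hp, -⟩ := hcond j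
  refine hp.sq_mul_ne_two hn ?_ (Subtype.ext h2)
  have : IsIntegral ℤ (algebraMap K (IntermediateField.adjoin K {u j, v j}) t) := ht.algebraMap
  have hroot : (⟨u j, IntermediateField.subset_adjoin K {u j, v j} (Set.mem_insert _ _)⟩ :
      IntermediateField.adjoin K {u j, v j}) ^ n = algebraMap K _ t := Subtype.ext (h.root j)
  rwa [← hroot] at this

theorem IsLegendrePointFamily.not_isOfFinAddOrder [DecidableEq K']
    (h : IsLegendrePointFamily t n u v P) (ht : IsIntegral ℤ t) (ht0 : t ≠ 0) (ht1 : t ≠ 1)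
    (hn_even : Even n) (hcond : ∀ i, InfiniteOrderConditions (legendreCurve t) (u i) (v i))
    (i : Fin n) : ¬ IsOfFinAddOrder (P i) := by
  intro hfin
  have hn : 0 < n := i.pos
  have hv0 := h.v_ne_zero ht ht1 hn_even hcond i
  obtain ⟨hns, hPi⟩ := h.point i
  set L := IntermediateField.adjoin K {u i, v i} with hL
  obtain ⟨𝔭, 𝔮, hne, hp, hq⟩ := hcond i
  set uL : L := ⟨u i, IntermediateField.subset_adjoin K {u i, v i} (Set.mem_insert _ _)⟩
  set vL : L := ⟨v i, IntermediateField.subset_adjoin K {u i, v i} (Set.mem_insert_of_mem _ rfl)⟩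
  have hyL : ((uL * (uL + 1) * vL : L) : K') = u i * (u i + 1) * v i := rfl
  have hnsL : ((legendreCurve t).baseChange L).toAffine.Nonsingular uL (uL * (uL + 1) * vL) :=
    (baseChange_nonsingular (legendreCurve t) (f := L.val) L.val.injective ..).1 hns
  set Q : ((legendreCurve t).baseChange L).toAffine.Point := .some uL (uL * (uL + 1) * vL) hnsL
  -- The primes live in L, so P i is descended to L; injectivity of the map on points preserves its
  -- order.
  have hQ : Point.map (W' := legendreCurve t) L.val Q = P i := by rw [hPi]; rfl
  have hQfin : IsOfFinAddOrder Q := by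
    rw [← hQ] at hfin
    exact ((Point.map_injective (W' := legendreCurve t) L.val).isOfFinAddOrder_iff).1 hfin
  have htL : IsIntegral ℤ (algebraMap K L t) := ht.algebraMap
  have huL : uL ^ n = algebraMap K L t := Subtype.ext (h.root i)
  have hvL : vL ^ 2 * (uL + 1) = uL ^ (n - 1) + 1 := Subtype.ext (h.sq_mul ht1 hn_even i)
  have ha₄ : ((legendreCurve t).baseChange L).a₄ = algebraMap K L t := rfl
  have hred : ∀ 𝔯 : HeightOneSpectrum (𝓞 L),
      ConditionsAt ((legendreCurve t).baseChange L) uL vL 𝔯 →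
      ReducesToZero (𝔯.valuation L) (Q + Q) := by
    intro 𝔯 hr
    obtain ⟨h1, h2⟩ := hr.valuation_sq_sub_eq_one htL hn huL hvL
    exact (isIntegralTwoTorsionForm_legendreCurve ht 𝔯).reducesToZero_add_self hnsL h2 h1
  have hQQ : Q + Q = 0 := by
    refine (isIntegralTwoTorsionForm_legendreCurve ht 𝔭).eq_zero_of_isOfFinAddOrder
      (isIntegralTwoTorsionForm_legendreCurve ht 𝔮) (fun l hl ↦ ?_) (hred 𝔭 hp) (hred 𝔮 hq)
      (hQfin.add hQfin)
    rcases valuation_natCast_eq_one_or_under_eq 𝔭 hl with h1 | h1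
    · exact .inl h1
    rcases valuation_natCast_eq_one_or_under_eq 𝔮 hl with h2 | h2
    · exact .inr h2
    · exact absurd (h1.trans h2.symm) hne
  -- A point killed by 2 equals its negative, so its ordinate vanishes.
  have hyy : uL * (uL + 1) * vL = -(uL * (uL + 1) * vL) := by
    by_contra hyy
    rw [← (isIntegralTwoTorsionForm_legendreCurve ht 𝔭).negY_eq uL] at hyy
    rw [Point.add_self_of_Y_ne hyy] at hQQ
    exact Point.some_ne_zero _ hQQ
  have hyy' := self_eq_neg.1 (congrArg (algebraMap L K') hyy)
  exact mul_ne_zero (mul_ne_zero (h.ne_zero ht0 i) (h.add_one_ne_zero ht1 hn_even i)) hv0 hyy'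

end InfiniteOrder

theorem mainTheorem8 (K : Type w) [Field K] [NumberField K] (t : 𝓞 K) (ht0 : t ≠ 0)
    (ht1 : t ≠ 1) (n : ℕ) (hn : 4 ≤ n) (hn_even : Even n) :
    -- existence of a finite solvable extension over which the curve has these `n` points
    (∃ (K' : Type w) (_ : Field K') (_ : Algebra K K'),
      FiniteDimensional K K' ∧ IsGalois K K' ∧ Group.IsSolvable Gal(K'/K) ∧
      ∃ (u v : Fin n → K')
        (P : Fin n → ((legendreCurve (t : K)).baseChange K').toAffine.Point),
        IsLegendrePointFamily (t : K) n u v P) ∧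
    -- the points have infinite order if the conditions hold for every root of `X ^ n - t`
    (∀ (K' : Type w) [Field K'] [NumberField K'] [Algebra K K'] [DecidableEq K']
      (u v : Fin n → K')
      (P : Fin n → ((legendreCurve (t : K)).baseChange K').toAffine.Point),
      IsLegendrePointFamily (t : K) n u v P →
      (∀ i, InfiniteOrderConditions (legendreCurve (t : K)) (u i) (v i)) →
      ∀ i, ¬ IsOfFinAddOrder (P i)) := by
  have h0 : (t : K) ≠ 0 := by exact_mod_cast ht0
  have h1 : (t : K) ≠ 1 := by exact_mod_cast ht1
  refine ⟨exists_isLegendrePointFamily K (t : K) h0 h1 n (by omega) hn_even, ?_⟩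
  intro K' _ _ _ _ u v P h hcond i
  exact h.not_isOfFinAddOrder (RingOfIntegers.isIntegral_coe t) h0 h1 hn_even hcond i
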